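/- Let $S=\prod_p p^{\varepsilon_p}$ be a supernatural number, that is, a formal product over all primes $p$ with exponents $\varepsilon_p\in\{0,1,2,\dots,\infty\}$; a positive integer $l$ divides $S$ (written $l\mid S$) if for every prime $p$ the exponent of $p$ in $l$ is at most $\varepsilon_p$. Let $$G_S=\{k/l\in\mathbb Q : k\in\mathbb Z,\ l\ge 1,\ l\mid S\}\subseteq\mathbb Q ,$$ $$\mathbb Z/S\mathbb Z=\varprojlim_{l\mid S}\mathbb Z/l\mathbb Z=\Big\{(x_l)_l\in\prod_{l\mid S}\mathbb Z/l\mathbb Z : x_l\equiv x_k \ (\mathrm{mod}\ k)\text{ whenever } k\mid l\Big\},$$ the latter with the subspace topology of the product of the discrete groups $\mathbb Z/l\mathbb Z$ (the odometer group), and let $q:\mathbb Z\to\mathbb Z/S\mathbb Z$, $q(x)=(x \bmod l)_{l}$. Then the cyclic subgroup $q(\mathbb Z)$ is dense in $\mathbb Z/S\mathbb Z$, and there is an isomorphism of abelian groups $$\mathrm{Ext}^1_{\mathbb Z}(G_S,\mathbb Z)\;\cong\;(\mathbb Z/S\mathbb Z)/q(\mathbb Z).$$ -/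

import Mathlib

/-- A supernatural number `∏ p ^ ε_p`, `ε_p ∈ {0, 1, …, ∞}`, given by its exponents. -/
@[ext]
structure Supernatural where
  /-- The exponent `ε_p` of the prime `p`. -/
  exp : Nat.Primes → ℕ∞

namespace Supernatural

/-- The product of supernatural numbers adds the exponents. -/
instance : Mul Supernatural := ⟨fun S T => ⟨fun p => S.exp p + T.exp p⟩⟩

instance : Dvd Supernatural := ⟨fun S T => ∃ S' : Supernatural, T = S * S'⟩

theorem dvd_iff {S T : Supernatural} : S ∣ T ↔ ∀ p, S.exp p ≤ T.exp p := by
  constructor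
  · rintro ⟨S', rfl⟩ p
    exact le_self_add
  · intro h
    refine ⟨⟨fun p => T.exp p - S.exp p⟩, ?_⟩
    ext1
    funext p
    exact (add_tsub_cancel_of_le (h p)).symm

/-- A positive integer as a supernatural number, through its prime factorization. -/
def ofPNat (l : ℕ+) : Supernatural := ⟨fun p => ((l : ℕ).factorization (p : ℕ) : ℕ∞)⟩

/-- The set of finite divisors of `S`. -/
def divisors (S : Supernatural) : Set ℕ+ := {l | ofPNat l ∣ S}

theorem one_mem_divisors (S : Supernatural) : 1 ∈ S.divisors := by
  refine dvd_iff.2 fun p => ?_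
  simp [ofPNat]

theorem lcm_mem_divisors {S : Supernatural} {k l : ℕ+} (hk : k ∈ S.divisors)
    (hl : l ∈ S.divisors) : PNat.lcm k l ∈ S.divisors := by
  refine dvd_iff.2 fun p => ?_
  have h1 := dvd_iff.1 hk p
  have h2 := dvd_iff.1 hl p
  simp only [ofPNat, PNat.lcm_coe] at h1 h2 ⊢
  rw [Nat.factorization_lcm k.ne_zero l.ne_zero, Finsupp.sup_apply]
  rcases le_total ((k : ℕ).factorization p) ((l : ℕ).factorization p) with h | h
  · rwa [sup_eq_right.2 h]
  · rwa [sup_eq_left.2 h]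

/-- The group `G_S = {k / l ∈ ℚ : k ∈ ℤ, l ∣ S}`. -/
def fractions (S : Supernatural) : AddSubgroup ℚ where
  carrier := {x | ∃ k : ℤ, ∃ l ∈ S.divisors, x = (k : ℚ) / ((l : ℕ) : ℚ)}
  zero_mem' := ⟨0, 1, S.one_mem_divisors, by simp⟩
  neg_mem' := by
    rintro _ ⟨k, l, hl, rfl⟩
    exact ⟨-k, l, hl, by push_cast; ring⟩
  add_mem' := by
    rintro _ _ ⟨k, l, hl, rfl⟩ ⟨k', l', hl', rfl⟩
    obtain ⟨a, ha⟩ := PNat.dvd_lcm_left l l'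
    obtain ⟨b, hb⟩ := PNat.dvd_lcm_right l l'
    refine ⟨k * (a : ℕ) + k' * (b : ℕ), PNat.lcm l l', lcm_mem_divisors hl hl', ?_⟩
    have ha' : ((PNat.lcm l l' : ℕ) : ℚ) = ((l : ℕ) : ℚ) * ((a : ℕ) : ℚ) := by
      rw [ha]; push_cast; rfl
    have hb' : ((PNat.lcm l l' : ℕ) : ℚ) = ((l' : ℕ) : ℚ) * ((b : ℕ) : ℚ) := by
      rw [hb]; push_cast; rfl
    have h1 : ((l : ℕ) : ℚ) ≠ 0 := by exact_mod_cast l.ne_zero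
    have h2 : ((l' : ℕ) : ℚ) ≠ 0 := by exact_mod_cast l'.ne_zero
    have h3 : ((a : ℕ) : ℚ) ≠ 0 := by exact_mod_cast a.ne_zero
    have h4 : ((b : ℕ) : ℚ) ≠ 0 := by exact_mod_cast b.ne_zero
    have e1 : (k : ℚ) / ((l : ℕ) : ℚ) = (k * (a : ℕ)) / ((PNat.lcm l l' : ℕ) : ℚ) := by
      rw [ha']; field_simp
    have e2 : (k' : ℚ) / ((l' : ℕ) : ℚ) = (k' * (b : ℕ)) / ((PNat.lcm l l' : ℕ) : ℚ) := by
      rw [hb']; field_simp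
    rw [e1, e2]
    push_cast
    ring

/-- The ring `ℤ/Sℤ`, the inverse limit of the rings `ℤ/lℤ` over the finite divisors `l` of `S`
along the reduction maps. As a subring of the product it carries the subspace topology of the
product of the discrete spaces `ℤ/lℤ`. -/
def odometer (S : Supernatural) : Subring (∀ l : S.divisors, ZMod ((l : ℕ+) : ℕ)) where
  carrier := {x | ∀ (k l : S.divisors) (h : ((k : ℕ+) : ℕ) ∣ ((l : ℕ+) : ℕ)),
    ZMod.castHom h (ZMod ((k : ℕ+) : ℕ)) (x l) = x k}
  zero_mem' := fun _ _ h => map_zero (ZMod.castHom h _)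
  one_mem' := fun _ _ h => map_one (ZMod.castHom h _)
  add_mem' := fun {x y} hx hy k l h => by
    rw [Pi.add_apply, map_add, hx, hy, Pi.add_apply]
  mul_mem' := fun {x y} hx hy k l h => by
    rw [Pi.mul_apply, map_mul, hx, hy, Pi.mul_apply]
  neg_mem' := fun {x} hx k l h => by
    rw [Pi.neg_apply, map_neg, hx, Pi.neg_apply]

/-- The homomorphism `q : ℤ → ℤ/Sℤ`, `q x = (x mod l)_l`. -/
def q (S : Supernatural) : ℤ →+ S.odometer where
  toFun x := ⟨fun l => (x : ZMod ((l : ℕ+) : ℕ)), fun _ _ h => map_intCast (ZMod.castHom h _) x⟩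
  map_zero' := by ext l; simp
  map_add' x y := by ext l; simp

end Supernatural

/-! As `ℚ` is injective, the sequence `ℤ → ℚ → ℚ/ℤ` identifies `Ext¹(G, ℤ)` with the characters `G →
ℚ/ℤ` modulo those that lift to `ℚ`. For `G = G_S`, a character killing `1` sends `1 / l` to an
`l`-torsion element `x_l / l`, and the `x_l` are compatible: such characters are exactly the points
of the odometer (`characterHom`, `exists_characterHom_eq`). Subtracting a liftable character makes
any character kill `1`, so the odometer maps onto `Ext¹`; the kernel is `q(ℤ)`, because a lift of a
character killing `1` is multiplication by an integer. -/

open CategoryTheory Abelian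

/-! ### `Ext¹(G, ℤ)` through characters. -/

/-- The short complex `ℤ → ℚ → ℚ/ℤ` of abelian groups. -/
noncomputable def intRatCircle : ShortComplex (ModuleCat.{0} ℤ) where
  X₁ := ModuleCat.of ℤ ℤ
  X₂ := ModuleCat.of ℤ ℚ
  X₃ := ModuleCat.of ℤ (AddCircle (1 : ℚ))
  f := ModuleCat.ofHom (Int.castAddHom ℚ).toIntLinearMap
  g := ModuleCat.ofHom (QuotientAddGroup.mk' (AddSubgroup.zmultiples (1 : ℚ))).toIntLinearMap
  zero := by
    ext
    exact AddCircle.coe_period 1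

theorem intRatCircle_shortExact : intRatCircle.ShortExact where
  exact := by
    rw [ShortComplex.ShortExact.moduleCat_exact_iff_function_exact]
    intro x
    refine (AddCircle.coe_eq_zero_iff (1 : ℚ)).trans (exists_congr fun n => ?_)
    change n • (1 : ℚ) = x ↔ (n : ℚ) = x
    rw [zsmul_one]
  mono_f := (ModuleCat.mono_iff_injective _).2 (Int.cast_injective (α := ℚ))
  epi_g := (ModuleCat.epi_iff_surjective _).2
    (QuotientAddGroup.mk'_surjective (AddSubgroup.zmultiples (1 : ℚ)))

instance injective_intRatCircle_X₂ : Injective intRatCircle.X₂ :=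
  (AddCommGrpCat.injective_as_module_iff ℚ).2 inferInstance

/-- The connecting homomorphism `Hom(G, ℚ/ℤ) → Ext¹(G, ℤ)` of the sequence `ℤ → ℚ → ℚ/ℤ`. -/
noncomputable def extOfCharacter (G : Type) [AddCommGroup G] :
    (G →+ AddCircle (1 : ℚ)) →+ Ext (ModuleCat.of ℤ G) (ModuleCat.of ℤ ℤ) 1 where
  toFun f := (Ext.mk₀ (show ModuleCat.of ℤ G ⟶ intRatCircle.X₃ from
    ModuleCat.ofHom f.toIntLinearMap)).comp intRatCircle_shortExact.extClass (zero_add 1)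
  map_zero' := by
    change (Ext.mk₀ 0).comp _ _ = _
    rw [Ext.mk₀_zero, Ext.zero_comp]
    rfl
  map_add' f g := by
    refine Eq.trans ?_ (Ext.add_comp _ _ _ _)
    rw [← Ext.mk₀_add]
    rfl

/-- The next term of the long exact sequence, `Ext¹(G, ℚ)`, vanishes. -/
theorem extOfCharacter_surjective (G : Type) [AddCommGroup G] :
    Function.Surjective (extOfCharacter G) := by
  intro e
  obtain ⟨x, hx⟩ := Ext.covariant_sequence_exact₁ (ModuleCat.of ℤ G) intRatCircle_shortExact
    (show Ext (ModuleCat.of ℤ G) intRatCircle.X₁ 1 from e) (Ext.eq_zero_of_injective _) (zero_add 1)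
  obtain ⟨f, rfl⟩ := Ext.mk₀_bijective _ _ |>.surjective x
  exact ⟨f.hom.toAddMonoidHom, hx⟩

theorem extOfCharacter_eq_zero_iff {G : Type} [AddCommGroup G] (f : G →+ AddCircle (1 : ℚ)) :
    extOfCharacter G f = 0 ↔ ∃ h : G →+ ℚ, ∀ g, f g = (h g : AddCircle (1 : ℚ)) := by
  constructor
  · intro hf
    obtain ⟨x, hx⟩ := Ext.covariant_sequence_exact₃ (ModuleCat.of ℤ G) intRatCircle_shortExact
      _ (zero_add 1) hf
    obtain ⟨h, rfl⟩ := Ext.mk₀_bijective _ _ |>.surjective x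
    rw [Ext.mk₀_comp_mk₀] at hx
    have := (Ext.mk₀_bijective _ _).injective hx
    exact ⟨h.hom.toAddMonoidHom, fun g => (ConcreteCategory.congr_hom this g).symm⟩
  · rintro ⟨h, hh⟩
    have : (show ModuleCat.of ℤ G ⟶ intRatCircle.X₃ from ModuleCat.ofHom f.toIntLinearMap) =
        (show ModuleCat.of ℤ G ⟶ intRatCircle.X₂ from ModuleCat.ofHom h.toIntLinearMap) ≫
          intRatCircle.g := by
      ext g
      exact hh g
    change (Ext.mk₀ _).comp _ (zero_add 1) = _
    rw [this, ← Ext.mk₀_comp_mk₀, Ext.comp_assoc_of_second_deg_zero,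
      intRatCircle_shortExact.comp_extClass, Ext.comp_zero]
    rfl

/-! ### Torsion of `ℚ/ℤ`. -/

/-- The embedding of `ℤ/nℤ` in `ℚ/ℤ` as the `n`-torsion, `a ↦ a / n`. -/
noncomputable def zmodToCircle (n : ℕ) : ZMod n →+ AddCircle (1 : ℚ) :=
  ZMod.lift n ⟨(QuotientAddGroup.mk' (AddSubgroup.zmultiples (1 : ℚ))).comp
    ((AddMonoidHom.mulRight (n : ℚ)⁻¹).comp (Int.castAddHom ℚ)), by
      refine (AddCircle.coe_eq_zero_iff (1 : ℚ)).2 ?_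
      -- For `n = 0` the convention `0⁻¹ = 0` makes the map zero; otherwise `n * n⁻¹ = 1` is a
      -- period.
      rcases eq_or_ne (n : ℚ) 0 with h | h
      · exact ⟨0, by simp [h]⟩
      · exact ⟨1, by simp [h]⟩⟩

theorem zmodToCircle_intCast (n : ℕ) (a : ℤ) :
    zmodToCircle n a = ((a / n : ℚ) : AddCircle (1 : ℚ)) := by
  rw [zmodToCircle, ZMod.lift_coe, div_eq_mul_inv]
  rfl

theorem zmodToCircle_injective {n : ℕ} (hn : n ≠ 0) : Function.Injective (zmodToCircle n) := by
  rw [injective_iff_map_eq_zero]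
  intro x hx
  obtain ⟨a, rfl⟩ := ZMod.intCast_surjective x
  rw [zmodToCircle_intCast, AddCircle.coe_eq_zero_iff] at hx
  obtain ⟨m, hm⟩ := hx
  have hn' : (n : ℚ) ≠ 0 := Nat.cast_ne_zero.2 hn
  rw [zsmul_one, eq_div_iff hn'] at hm
  have : a = m * n := by exact_mod_cast hm.symm
  simp [this]

theorem exists_zmodToCircle_eq {n : ℕ} (hn : n ≠ 0) {y : AddCircle (1 : ℚ)} (hy : n • y = 0) :
    ∃ x, zmodToCircle n x = y := by
  obtain ⟨r, rfl⟩ := QuotientAddGroup.mk_surjective y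
  obtain ⟨m, hm⟩ := (AddCircle.coe_eq_zero_iff (1 : ℚ)).1 hy
  have hn' : (n : ℚ) ≠ 0 := Nat.cast_ne_zero.2 hn
  refine ⟨(m : ZMod n), ?_⟩
  rw [zmodToCircle_intCast]
  congr 1
  change m • (1 : ℚ) = n • r at hm
  rw [zsmul_one, nsmul_eq_mul] at hm
  rw [hm]
  field_simp

/-- Since `a / k = m * (a / l)`, reduction of residues becomes multiplication by `m` on torsion
points. -/
theorem zmodToCircle_castHom {k l m : ℕ} (hm : m ≠ 0) (h : l = k * m) (x : ZMod l) :
    zmodToCircle k (ZMod.castHom (Dvd.intro m h.symm) (ZMod k) x) = m • zmodToCircle l x := by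
  obtain ⟨a, rfl⟩ := ZMod.intCast_surjective x
  have hm' : (m : ℚ) ≠ 0 := Nat.cast_ne_zero.2 hm
  rw [map_intCast, zmodToCircle_intCast, zmodToCircle_intCast, ← AddCircle.coe_nsmul]
  congr 1
  rw [h, nsmul_eq_mul]
  push_cast
  field_simp

namespace Supernatural

variable {S : Supernatural}

theorem mem_divisors_of_dvd {k l : ℕ+} (h : (k : ℕ) ∣ l) (hl : l ∈ S.divisors) :
    k ∈ S.divisors := by
  refine dvd_iff.2 fun p => le_trans ?_ (dvd_iff.1 hl p)
  exact Nat.cast_le.2 ((Nat.factorization_le_iff_dvd k.ne_zero l.ne_zero).2 h p)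

/-! ### Density of the integers. -/

theorem dense_range_q (S : Supernatural) :
    Dense ((S.q.range : AddSubgroup S.odometer) : Set S.odometer) := by
  have common : ∀ I : Finset S.divisors, ∃ L : S.divisors, ∀ l ∈ I, (l : ℕ) ∣ (L : ℕ) := by
    classical
    intro I
    induction I using Finset.induction_on with
    | empty => exact ⟨⟨1, S.one_mem_divisors⟩, by simp⟩
    | insert a s _ ih =>
      obtain ⟨L, hL⟩ := ih
      refine ⟨⟨PNat.lcm a L, lcm_mem_divisors a.2 L.2⟩, fun l hl => ?_⟩
      rcases Finset.mem_insert.1 hl with rfl | hl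
      · exact PNat.dvd_iff.1 (PNat.dvd_lcm_left _ _)
      · exact (hL l hl).trans (PNat.dvd_iff.1 (PNat.dvd_lcm_right _ _))
  intro x
  rw [mem_closure_iff]
  rintro o ho hx
  obtain ⟨U, hU, rfl⟩ := isOpen_induced_iff.1 ho
  obtain ⟨I, u, hu, hIU⟩ := isOpen_pi_iff.1 hU x.1 hx
  -- A basic open set constrains finitely many coordinates, all determined by the one at a common
  -- multiple `L`; an integer matching that one suffices.
  obtain ⟨L, hL⟩ := common I
  obtain ⟨a, ha⟩ := ZMod.intCast_surjective (x.1 L)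
  refine ⟨S.q a, hIU fun l hl => ?_, a, rfl⟩
  have : (S.q a).1 l = x.1 l := by
    rw [← x.2 l L (hL l hl), ← ha, map_intCast]
    rfl
  rw [this]
  exact (hu l hl).2

/-! ### Odometer points as characters of `G_S`. -/

/-- The value of `zmodToCircle` at a coordinate of a point of the odometer. -/
noncomputable def coordToCircle (l : S.divisors) : S.odometer →+ AddCircle (1 : ℚ) :=
  (zmodToCircle (l : ℕ)).comp
    ((Pi.evalAddMonoidHom (fun l : S.divisors => ZMod (l : ℕ)) l).comp
      S.odometer.subtype.toAddMonoidHom)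

theorem coordToCircle_apply (l : S.divisors) (x : S.odometer) :
    coordToCircle l x = zmodToCircle (l : ℕ) (x.1 l) := rfl

theorem coordToCircle_eq_nsmul {k l : S.divisors} {m : ℕ} (h : (l : ℕ) = k * m)
    (x : S.odometer) : coordToCircle k x = m • coordToCircle l x := by
  have hm : m ≠ 0 := by
    rintro rfl
    exact l.1.ne_zero h
  rw [coordToCircle_apply, coordToCircle_apply, ← zmodToCircle_castHom hm h,
    x.2 k l (Dvd.intro m h.symm)]

/-- Independence of the chosen fraction: both sides are compared at the lcm of the denominators. -/
theorem zsmul_coordToCircle_eq {k l : S.divisors} {a b : ℤ}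
    (h : (a : ℚ) / (k : ℕ) = b / (l : ℕ)) (x : S.odometer) :
    a • coordToCircle k x = b • coordToCircle l x := by
  let L : S.divisors := ⟨PNat.lcm k l, lcm_mem_divisors k.2 l.2⟩
  obtain ⟨m, hm⟩ : (k : ℕ) ∣ (L : ℕ) := PNat.dvd_iff.1 (PNat.dvd_lcm_left _ _)
  obtain ⟨n, hn⟩ : (l : ℕ) ∣ (L : ℕ) := PNat.dvd_iff.1 (PNat.dvd_lcm_right _ _)
  have hk : ((k : ℕ) : ℚ) ≠ 0 := Nat.cast_ne_zero.2 k.1.ne_zero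
  have hl : ((l : ℕ) : ℚ) ≠ 0 := Nat.cast_ne_zero.2 l.1.ne_zero
  have hmn : ((k : ℕ) : ℚ) * m = (l : ℕ) * n := by exact_mod_cast hm.symm.trans hn
  have key : a * (m : ℤ) = b * (n : ℤ) := by
    have : (a : ℚ) * m = b * n := by
      rw [div_eq_div_iff hk hl] at h
      refine mul_left_cancel₀ (mul_ne_zero hk hl) ?_
      linear_combination ((k : ℕ) * m : ℚ) * h + (b * (k : ℕ) : ℚ) * hmn
    exact_mod_cast this
  rw [coordToCircle_eq_nsmul hm, coordToCircle_eq_nsmul hn, ← natCast_zsmul, ← natCast_zsmul,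
    smul_smul, smul_smul, key]

theorem den_mem_divisors (g : S.fractions) : g.1.pnatDen ∈ S.divisors := by
  obtain ⟨k, l, hl, h⟩ := g.2
  refine mem_divisors_of_dvd ?_ hl
  rw [Rat.coe_pnatDen, h]
  exact_mod_cast Rat.den_dvd k l

/-- The denominator of an element of `G_S`. -/
def den (g : S.fractions) : S.divisors := ⟨g.1.pnatDen, den_mem_divisors g⟩

theorem num_div_den (g : S.fractions) : (g.1.num : ℚ) / (den g : ℕ) = g.1 :=
  Rat.num_div_den g.1

/-- The character `k / l ↦ k x_l / l` of `G_S` given by a point `x` of the odometer. -/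
noncomputable def character (x : S.odometer) : S.fractions →+ AddCircle (1 : ℚ) :=
  -- The reduced fraction fixes the value; additivity follows over a common denominator `L`.
  AddMonoidHom.mk' (fun g => g.1.num • coordToCircle (den g) x) fun g h => by
    let L : S.divisors := ⟨PNat.lcm (den g) (den h), lcm_mem_divisors (den g).2 (den h).2⟩
    obtain ⟨m, hm⟩ : (den g : ℕ) ∣ (L : ℕ) := PNat.dvd_iff.1 (PNat.dvd_lcm_left _ _)
    obtain ⟨n, hn⟩ : (den h : ℕ) ∣ (L : ℕ) := PNat.dvd_iff.1 (PNat.dvd_lcm_right _ _)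
    have hL : ((L : ℕ) : ℚ) ≠ 0 := Nat.cast_ne_zero.2 L.1.ne_zero
    have hm' : ((L : ℕ) : ℚ) = (den g : ℕ) * m := by exact_mod_cast hm
    have hn' : ((L : ℕ) : ℚ) = (den h : ℕ) * n := by exact_mod_cast hn
    have eg : g.1 = ((g.1.num * m : ℤ) : ℚ) / (L : ℕ) := by
      have := num_div_den g
      rw [div_eq_iff (Nat.cast_ne_zero.2 (den g).1.ne_zero)] at this
      rw [eq_div_iff hL, hm']
      push_cast
      rw [this, mul_assoc]
    have eh : h.1 = ((h.1.num * n : ℤ) : ℚ) / (L : ℕ) := by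
      have := num_div_den h
      rw [div_eq_iff (Nat.cast_ne_zero.2 (den h).1.ne_zero)] at this
      rw [eq_div_iff hL, hn']
      push_cast
      rw [this, mul_assoc]
    rw [zsmul_coordToCircle_eq (l := L) ((num_div_den g).trans eg),
      zsmul_coordToCircle_eq (l := L) ((num_div_den h).trans eh), ← add_zsmul]
    refine zsmul_coordToCircle_eq ((num_div_den (g + h)).trans ?_) x
    rw [AddSubgroup.coe_add]
    nth_rewrite 1 [eg, eh]
    push_cast
    ring

theorem character_eq_zsmul (x : S.odometer) {g : S.fractions} {k : ℤ} {l : S.divisors}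
    (h : g.1 = k / (l : ℕ)) : character x g = k • coordToCircle l x :=
  zsmul_coordToCircle_eq ((num_div_den g).trans h) x

/-- The element `1 / l` of `G_S`. -/
def unitFraction (l : S.divisors) : S.fractions :=
  ⟨1 / (l : ℕ), 1, l, l.2, by simp⟩

theorem character_unitFraction (x : S.odometer) (l : S.divisors) :
    character x (unitFraction l) = zmodToCircle (l : ℕ) (x.1 l) := by
  rw [character_eq_zsmul x (k := 1) (l := l) (by simp [unitFraction]), one_zsmul,
    coordToCircle_apply]

/-- The element `1` of `G_S`. -/
def oneFraction (S : Supernatural) : S.fractions := unitFraction ⟨1, S.one_mem_divisors⟩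

theorem coe_oneFraction : (S.oneFraction : ℚ) = 1 := by
  simp [oneFraction, unitFraction]

theorem nsmul_unitFraction (l : S.divisors) : (l : ℕ) • unitFraction l = S.oneFraction := by
  have hl : ((l : ℕ) : ℚ) ≠ 0 := Nat.cast_ne_zero.2 l.1.ne_zero
  ext
  rw [coe_oneFraction]
  simp [unitFraction, hl]

theorem nsmul_unitFraction_of_eq_mul {k l : S.divisors} {m : ℕ} (h : (l : ℕ) = k * m) :
    m • unitFraction l = unitFraction k := by
  have hl : ((l : ℕ) : ℚ) ≠ 0 := Nat.cast_ne_zero.2 l.1.ne_zero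
  have hk : ((k : ℕ) : ℚ) ≠ 0 := Nat.cast_ne_zero.2 k.1.ne_zero
  have h' : ((l : ℕ) : ℚ) = (k : ℕ) * m := by exact_mod_cast h
  ext
  change m • (1 / ((l : ℕ) : ℚ)) = 1 / ((k : ℕ) : ℚ)
  rw [nsmul_eq_mul, mul_one_div, div_eq_div_iff hl hk, h']
  ring

theorem addMonoidHom_ext_unitFraction {A : Type*} [AddCommGroup A] {f f' : S.fractions →+ A}
    (h : ∀ l, f (unitFraction l) = f' (unitFraction l)) : f = f' := by
  ext g
  have : g = g.1.num • unitFraction (den g) := by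
    ext
    rw [AddSubgroup.coe_zsmul, zsmul_eq_mul, unitFraction, mul_one_div]
    exact (num_div_den g).symm
  rw [this, map_zsmul, map_zsmul, h]

/-- The map from the odometer to the characters of `G_S`, as a homomorphism. -/
noncomputable def characterHom (S : Supernatural) :
    S.odometer →+ (S.fractions →+ AddCircle (1 : ℚ)) :=
  AddMonoidHom.mk' character fun x y => by
    refine addMonoidHom_ext_unitFraction fun l => ?_
    rw [AddMonoidHom.add_apply]
    simp only [character_unitFraction]
    exact map_add _ _ _

theorem characterHom_unitFraction (x : S.odometer) (l : S.divisors) :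
    S.characterHom x (unitFraction l) = zmodToCircle (l : ℕ) (x.1 l) :=
  character_unitFraction x l

theorem exists_characterHom_eq {f : S.fractions →+ AddCircle (1 : ℚ)}
    (hf : f S.oneFraction = 0) : ∃ x, S.characterHom x = f := by
  have h : ∀ l : S.divisors, ∃ y, zmodToCircle (l : ℕ) y = f (unitFraction l) := fun l =>
    exists_zmodToCircle_eq l.1.ne_zero (by rw [← map_nsmul, nsmul_unitFraction, hf])
  choose y hy using h
  refine ⟨⟨y, fun k l hkl => ?_⟩, addMonoidHom_ext_unitFraction fun l => ?_⟩
  · obtain ⟨m, hm⟩ := id hkl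
    have hm0 : m ≠ 0 := by
      rintro rfl
      exact l.1.ne_zero hm
    apply zmodToCircle_injective k.1.ne_zero
    rw [zmodToCircle_castHom hm0 hm, hy, hy, ← map_nsmul, nsmul_unitFraction_of_eq_mul hm]
  · rw [characterHom_unitFraction, hy]

/-! ### Kernel and image of the map to `Ext¹`. -/

theorem ker_extOfCharacter_comp_characterHom (S : Supernatural) :
    ((extOfCharacter S.fractions).comp S.characterHom).ker = S.q.range := by
  ext x
  rw [AddMonoidHom.mem_ker, AddMonoidHom.comp_apply, extOfCharacter_eq_zero_iff]
  constructor
  · rintro ⟨h, hh⟩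
    have h1 := hh S.oneFraction
    -- The character of `x` kills `1` because `ℤ/1ℤ` is trivial, so the lift `h` takes an integer
    -- value `a` there.
    have hx : x.1 ⟨1, S.one_mem_divisors⟩ = 0 := Subsingleton.elim (α := ZMod 1) _ _
    rw [oneFraction, characterHom_unitFraction, hx, map_zero] at h1
    obtain ⟨a, ha⟩ := (AddCircle.coe_eq_zero_iff (1 : ℚ)).1 h1.symm
    rw [zsmul_one] at ha
    refine ⟨a, ?_⟩
    ext l
    apply zmodToCircle_injective l.1.ne_zero
    rw [← characterHom_unitFraction, ← characterHom_unitFraction, hh, characterHom_unitFraction]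
    refine (zmodToCircle_intCast _ _).trans ?_
    congr 1
    have hl : ((l : ℕ) : ℚ) ≠ 0 := Nat.cast_ne_zero.2 l.1.ne_zero
    rw [div_eq_iff hl, ha, mul_comm, ← nsmul_eq_mul, ← map_nsmul, nsmul_unitFraction]
    rfl
  · rintro ⟨a, rfl⟩
    refine ⟨a • S.fractions.subtype, fun g => ?_⟩
    refine DFunLike.congr_fun (addMonoidHom_ext_unitFraction (f := S.characterHom (S.q a))
      (f' := (QuotientAddGroup.mk' (AddSubgroup.zmultiples (1 : ℚ))).comp
        (a • S.fractions.subtype)) fun l => ?_) g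
    rw [characterHom_unitFraction]
    refine (zmodToCircle_intCast _ _).trans ?_
    change _ = ((a • (1 / ((l : ℕ) : ℚ)) : ℚ) : AddCircle (1 : ℚ))
    rw [zsmul_eq_mul, mul_one_div]

theorem extOfCharacter_comp_characterHom_surjective (S : Supernatural) :
    Function.Surjective ((extOfCharacter S.fractions).comp S.characterHom) := by
  intro e
  obtain ⟨f, rfl⟩ := extOfCharacter_surjective _ e
  -- Multiplication by a rational representative `r` of `f 1` is the liftable character to subtract.
  obtain ⟨r, hr⟩ := QuotientAddGroup.mk_surjective (f S.oneFraction)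
  let h : S.fractions →+ ℚ := (AddMonoidHom.mulLeft r).comp S.fractions.subtype
  let h' : S.fractions →+ AddCircle (1 : ℚ) :=
    (QuotientAddGroup.mk' (AddSubgroup.zmultiples (1 : ℚ))).comp h
  have h0 : extOfCharacter _ h' = 0 := (extOfCharacter_eq_zero_iff _).2 ⟨h, fun _ => rfl⟩
  obtain ⟨x, hx⟩ := exists_characterHom_eq (f := f - h') (by
    have : h S.oneFraction = r := by
      change r * (S.oneFraction : ℚ) = r
      rw [coe_oneFraction, mul_one]
    rw [AddMonoidHom.sub_apply, sub_eq_zero, ← hr]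
    change _ = ((h S.oneFraction : ℚ) : AddCircle (1 : ℚ))
    rw [this])
  exact ⟨x, by rw [AddMonoidHom.comp_apply, hx, map_sub, h0, sub_zero]⟩

end Supernatural

theorem mainTheorem9 (S : Supernatural) :
    Dense ((S.q.range : AddSubgroup S.odometer) : Set S.odometer) ∧
    Nonempty (CategoryTheory.Abelian.Ext (ModuleCat.of ℤ S.fractions) (ModuleCat.of ℤ ℤ) 1 ≃+
      S.odometer ⧸ S.q.range) := by
  refine ⟨S.dense_range_q, ⟨AddEquiv.symm ?_⟩⟩
  exact (QuotientAddGroup.quotientAddEquivOfEq S.ker_extOfCharacter_comp_characterHom.symm).trans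
    (QuotientAddGroup.quotientKerEquivOfSurjective _
      S.extOfCharacter_comp_characterHom_surjective)
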